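/- Let $H$ be a complex Hilbert space and $B(H)$ the algebra of bounded linear operators on $H$. An operator $T\in B(H)$ is Fredholm if its range $R(T)$ is closed and its null space $N(T)$ and the quotient $H/R(T)$ are finite dimensional; its index is $\dim N(T)-\dim H/R(T)$. The Weyl spectrum $\sigma_w(T)$ is the set of all $\lambda\in\mathbb{C}$ such that $T-\lambda$ is not a Fredholm operator of index zero. The essential spectrum $\sigma_e(T)$ is the spectrum of $\pi(T)$, where $\pi:B(H)\to B(H)/K(H)$ is the quotient map onto the Calkin algebra ($K(H)$ being the ideal of compact operators). $T$ is called essentially $G_1$ if $\|(\pi(T)-z)^{-1}\|=1/d(z,\sigma_e(T))$ for all $z\notin\sigma_e(T)$. A sequence $(T_n)$ in $B(H)$ is $\nu$-convergent to $T\in B(H)$, written $T_n\overset{\nu}{\to}T$, if $(\|T_n\|)$ is bounded, $\|(T_n-T)T\|\to 0$ and $\|(T_n-T)T_n\|\to 0$. (1) Let $T\in B(H)$ be a Fredholm operator such that $0\notin\sigma_w(T)$ or $0$ is an accumulation point of $\sigma_w(T)$. If $(T_n)$ is a sequence of essentially $G_1$ operators such that $T_n\overset{\nu}{\to}T$, then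 $\sigma_w(T_n)\to\sigma_w(T)$ in the Hausdorff metric. (2) The restriction of the Weyl spectrum to the class of essentially $G_1$ operators is $\nu$-continuous: if $T$ and all $T_n$ are essentially $G_1$ and $T_n\overset{\nu}{\to}T$, then $\sigma_w(T_n)\to\sigma_w(T)$ in the Hausdorff metric. (If $H$ is finite dimensional, the Calkin algebra is zero, every operator counts as essentially $G_1$, all Weyl spectra are empty, and the Hausdorff distance between empty sets is $0$.) -/

import Mathlib

open Filter Topology

noncomputable section

namespace NuWeyl

section BanachAlgebra

variable {A : Type*} [NormedRing A]

/-- `ν`-convergence of a sequence `u` to `x` in a normed ring: the norms `‖u n‖` are bounded,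
`‖(u n - x) x‖ → 0` and `‖(u n - x) (u n)‖ → 0`. -/
def NuConverges (u : ℕ → A) (x : A) : Prop :=
  (∃ M : ℝ, ∀ n, ‖u n‖ ≤ M) ∧
    Tendsto (fun n => ‖(u n - x) * x‖) atTop (𝓝 0) ∧
    Tendsto (fun n => ‖(u n - x) * u n‖) atTop (𝓝 0)

/-- Convergence of a sequence of subsets of `ℂ` with respect to the Hausdorff metric.
The distance takes values in `[0, ∞]`: it is the usual Hausdorff metric on non-empty compact sets,
it is `0` between two empty sets, and `∞` between an empty and a non-empty set. -/
def HausdorffConverges (E : ℕ → Set ℂ) (F : Set ℂ) : Prop :=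
  Tendsto (fun n => Metric.hausdorffEDist (E n) F) atTop (𝓝 0)

/-- The restriction to the class `S` of a set-valued function `τ` is `ν`-continuous
(at every point of `S`). -/
def NuContinuousOn (τ : A → Set ℂ) (S : Set A) : Prop :=
  ∀ x ∈ S, ∀ u : ℕ → A, (∀ n, u n ∈ S) → NuConverges u x →
    HausdorffConverges (fun n => τ (u n)) (τ x)

end BanachAlgebra

section Operators

variable {H : Type*} [NormedAddCommGroup H] [InnerProductSpace ℂ H]

/-- The index `dim N(T) - dim H / R(T)` (meaningful for Fredholm operators). -/
def index (T : H →L[ℂ] H) : ℤ :=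
  (Module.finrank ℂ (LinearMap.ker (T : H →ₗ[ℂ] H)) : ℤ) -
    (Module.finrank ℂ (H ⧸ LinearMap.range (T : H →ₗ[ℂ] H)) : ℤ)

/-- The Weyl spectrum: all `z` such that `T - z` is not a Fredholm operator of index zero. -/
def weylSpectrum (T : H →L[ℂ] H) : Set ℂ :=
  {z | ¬ ((T - z • (1 : H →L[ℂ] H)).IsFredholm ∧ index (T - z • (1 : H →L[ℂ] H)) = 0)}

variable (H) in
/-- The ideal of compact operators in the algebra of bounded operators on `H`. -/
def compactIdeal : Ideal (H →L[ℂ] H) where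
  carrier := {K | IsCompactOperator K}
  add_mem' hK hL := IsCompactOperator.add hK hL
  zero_mem' := isCompactOperator_zero
  smul_mem' T _ hK := IsCompactOperator.clm_comp hK T

instance : (compactIdeal H).IsTwoSided :=
  ⟨fun T hK => IsCompactOperator.comp_clm hK T⟩

variable (H) in
/-- The Calkin algebra, with the quotient algebra structure and the quotient norm. -/
abbrev Calkin : Type _ := (H →L[ℂ] H) ⧸ compactIdeal H

/-- The canonical homomorphism onto the Calkin algebra. -/
def toCalkin : (H →L[ℂ] H) →+* Calkin H := Ideal.Quotient.mk (compactIdeal H)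

/-- The essential spectrum: the spectrum of the image of `T` in the Calkin algebra. -/
def essentialSpectrum (T : H →L[ℂ] H) : Set ℂ := spectrum ℂ (toCalkin T)

/-- `T` is essentially `G₁`: the inverse of `π(T) - z` in the Calkin algebra has norm
`1 / d(z, σ_e(T))` for all `z` outside the essential spectrum. (If `H` is finite dimensional, the
Calkin algebra is zero, and both sides are `0`.) -/
def IsEssentiallyG1 (T : H →L[ℂ] H) : Prop :=
  ∀ z : ℂ, z ∉ essentialSpectrum T →
    ‖Ring.inverse (toCalkin T - algebraMap ℂ (Calkin H) z)‖ =
      1 / Metric.infDist z (essentialSpectrum T)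

end Operators

end NuWeyl

end

/-! Fredholm operators of index zero are the compact perturbations of invertible operators
(`isFredholm_index_zero_iff`), so `z ∉ σ_w(T)` means that `π(T) - z` lies in the image `G` of the
invertible operators. `G` is an open subgroup of the units of the Calkin algebra, hence also closed
in them, and a segment of units starting in `G` stays in `G`.

Let `b ∈ G`, `r = b⁻¹`. If `(x r)²` has norm below `1`, then every `b + s x` with `0 ≤ s ≤ 1` is a
unit, so `b + x ∈ G`. `ν`-convergence gives this smallness for `E = u n - a` although `E` itself
need not be small: it makes `E a`, `E (u n)` and therefore `E²` small, and the resolvent identity `v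
r = 1 + z r`, for `v = a` or `v = u n`, turns this into smallness of `E r E r` as long as `r` stays
bounded.

With `v = a` this yields upper semicontinuity of `σ_w`. With `v = u n` it yields lower
semicontinuity, where the `G₁` condition supplies the uniform bound on `r`. Compactness then gives
Hausdorff convergence. -/

noncomputable section

namespace NuWeyl

/-! ### Index-zero Fredholm operators and compact perturbations. -/

section Weyl

variable {H : Type*} [NormedAddCommGroup H] [InnerProductSpace ℂ H]

/-- On a Hilbert space, compact operators are norm limits of operators of finite rank. -/
theorem exists_finiteRank_norm_sub_le {K : H →L[ℂ] H}
    (hK : IsCompactOperator K) {ε : ℝ} (hε : 0 < ε) :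
    ∃ F : H →L[ℂ] H, (F : H →ₗ[ℂ] H).HasFiniteRange ∧ ‖K - F‖ ≤ ε := by
  have htb : TotallyBounded (K '' Metric.closedBall 0 1) := by
    obtain ⟨C, hC, hKC⟩ := hK.image_closedBall_subset_compact 1
    exact hC.totallyBounded.subset hKC
  obtain ⟨t, ht, hcover⟩ := Metric.totallyBounded_iff.1 htb ε hε
  -- `t` is a finite `ε`-net for the image of the unit ball; projecting onto its span moves `K x` no
  -- further than the distance to the net.
  let V : Submodule ℂ H := Submodule.span ℂ t
  have : FiniteDimensional ℂ V := FiniteDimensional.span_of_finite ℂ ht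
  refine ⟨V.starProjection ∘L K, ?_, ?_⟩
  · refine LinearMap.HasFiniteRange.comp_right (u := (K : H →ₗ[ℂ] H))
      (v := (V.starProjection : H →ₗ[ℂ] H)) ?_
    rw [LinearMap.HasFiniteRange, Submodule.fg_iff_finiteDimensional]
    refine Submodule.finiteDimensional_of_le (S₂ := V) ?_
    rintro _ ⟨x, rfl⟩
    exact V.starProjection_apply_mem x
  · refine ContinuousLinearMap.opNorm_le_of_unit_norm hε.le fun x hx => ?_
    have hx' : K x ∈ K '' Metric.closedBall 0 1 := ⟨x, by simp [hx], rfl⟩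
    obtain ⟨y, hy, hxy⟩ := Set.mem_iUnion₂.1 (hcover hx')
    have h1 : ‖K x - V.starProjection (K x)‖ ≤ ‖K x - y‖ := by
      rw [V.starProjection_minimal]
      exact ciInf_le (f := fun w : V => ‖K x - w‖) ⟨0, by rintro _ ⟨w, rfl⟩; positivity⟩
        ⟨y, Submodule.subset_span hy⟩
    calc ‖(K - V.starProjection ∘L K) x‖ = ‖K x - V.starProjection (K x)‖ := by simp
      _ ≤ ‖K x - y‖ := h1
      _ ≤ ε := by rw [← dist_eq_norm]; exact (Metric.mem_ball.1 hxy).le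

/-- Adding a finite rank map to the identity gives kernel and cokernel of equal dimension. -/
theorem finrank_ker_eq_finrank_coker_id_add {𝕜 V : Type*} [Field 𝕜] [AddCommGroup V] [Module 𝕜 V]
    {F : V →ₗ[𝕜] V} (hF : F.HasFiniteRange) :
    Module.finrank 𝕜 (LinearMap.ker (LinearMap.id + F)) =
      Module.finrank 𝕜 (V ⧸ LinearMap.range (LinearMap.id + F)) := by
  set M := LinearMap.range F with hM
  have : FiniteDimensional 𝕜 M := Submodule.fg_iff_finiteDimensional _ |>.1 hF
  have hmaps : ∀ x ∈ M, (LinearMap.id + F : V →ₗ[𝕜] V) x ∈ M := fun x hx =>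
    M.add_mem hx (LinearMap.mem_range_self F x)
  -- Everything reduces to the finite-dimensional `M`: the kernel lies in `M`, and `x ≡ F (-x)`
  -- modulo the range, so the cokernel is `M / range g`. Rank-nullity for `g` and `q` then
  -- concludes.
  let g : M →ₗ[𝕜] M := (LinearMap.id + F).restrict hmaps
  have hker : LinearMap.ker (LinearMap.id + F) ≤ M := fun x hx => by
    have : x = F (-x) := by
      rw [map_neg]; exact eq_neg_of_add_eq_zero_left (by simpa using hx)
    exact ⟨-x, this.symm⟩
  have e1 : Module.finrank 𝕜 (LinearMap.ker g) =
      Module.finrank 𝕜 (LinearMap.ker (LinearMap.id + F)) := by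
    have : LinearMap.ker g = (LinearMap.ker (LinearMap.id + F)).comap M.subtype := by
      ext x; simp [g, LinearMap.mem_ker, Subtype.ext_iff]
    rw [this]
    exact (Submodule.comapSubtypeEquivOfLe hker).finrank_eq
  let q : M →ₗ[𝕜] V ⧸ LinearMap.range (LinearMap.id + F) :=
    (LinearMap.range (LinearMap.id + F)).mkQ ∘ₗ M.subtype
  have hq : Function.Surjective q := fun y => by
    obtain ⟨x, rfl⟩ := Submodule.mkQ_surjective _ y
    refine ⟨⟨F (-x), LinearMap.mem_range_self F _⟩, ?_⟩
    refine (Submodule.Quotient.eq _).2 ⟨-x, ?_⟩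
    simp; abel
  have hqker : LinearMap.ker q = LinearMap.range g := by
    ext x
    constructor
    · intro hx
      have hx' : (x : V) ∈ LinearMap.range (LinearMap.id + F) := by simpa [q] using hx
      obtain ⟨y, hy⟩ := hx'
      have hyM : y ∈ M := by
        have : y = x - F y := by rw [← hy]; simp
        rw [this]
        exact M.sub_mem x.2 (LinearMap.mem_range_self F y)
      exact ⟨⟨y, hyM⟩, Subtype.ext hy⟩
    · rintro ⟨y, rfl⟩
      have : ((g y : M) : V) ∈ LinearMap.range (LinearMap.id + F) := ⟨y, rfl⟩
      simpa [q] using this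
  have e2 := LinearMap.finrank_range_add_finrank_ker g
  have e3 := LinearMap.finrank_range_add_finrank_ker q
  rw [LinearMap.range_eq_top.2 hq, finrank_top, hqker] at e3
  omega

/-- An invertible operator plus one of finite rank is Fredholm of index zero. -/
theorem isFredholm_index_zero_of_unit_add_finiteRank (U : (H →L[ℂ] H)ˣ) {F : H →L[ℂ] H}
    (hF : (F : H →ₗ[ℂ] H).HasFiniteRange) :
    ((U : H →L[ℂ] H) + F).IsFredholm ∧ index ((U : H →L[ℂ] H) + F) = 0 := by
  set W : H →L[ℂ] H := ((U⁻¹ : (H →L[ℂ] H)ˣ) : H →L[ℂ] H) with hW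
  have hWU : ∀ x, W ((U : H →L[ℂ] H) x) = x := fun x =>
    congrArg (fun A : H →L[ℂ] H => A x) U.inv_mul
  have hUW : ∀ x, (U : H →L[ℂ] H) (W x) = x := fun x =>
    congrArg (fun A : H →L[ℂ] H => A x) U.mul_inv
  constructor
  · refine ContinuousLinearMap.IsFredholm.of_isQuasiInverse (v := W) ⟨?_, ?_⟩
    · refine LinearMap.FiniteRangeSetoid.equiv_iff_hasFiniteRange.2 ?_
      have : ((W : H →ₗ[ℂ] H) ∘ₗ (((U : H →L[ℂ] H) + F : H →L[ℂ] H) : H →ₗ[ℂ] H)) - LinearMap.id =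
          (W : H →ₗ[ℂ] H) ∘ₗ (F : H →ₗ[ℂ] H) := by
        ext x; simp [hWU]
      rw [this]
      exact hF.comp_left _
    · refine LinearMap.FiniteRangeSetoid.equiv_iff_hasFiniteRange.2 ?_
      have : ((((U : H →L[ℂ] H) + F : H →L[ℂ] H) : H →ₗ[ℂ] H) ∘ₗ (W : H →ₗ[ℂ] H)) - LinearMap.id =
          (F : H →ₗ[ℂ] H) ∘ₗ (W : H →ₗ[ℂ] H) := by
        ext x; simp [hUW]
      rw [this]
      exact hF.comp_right _
  · let e : H ≃ₗ[ℂ] H := LinearEquiv.ofLinearMap (U : H →L[ℂ] H) W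
      (LinearMap.ext hUW) (LinearMap.ext hWU)
    -- `U + F = U (1 + U⁻¹ F)`, and the factor `U` changes neither dimension.
    let G : H →ₗ[ℂ] H := LinearMap.id + (W : H →ₗ[ℂ] H) ∘ₗ (F : H →ₗ[ℂ] H)
    have hT : (((U : H →L[ℂ] H) + F : H →L[ℂ] H) : H →ₗ[ℂ] H) = (e : H →ₗ[ℂ] H) ∘ₗ G := by
      ext x; simp [e, G, hUW]
    have hk : LinearMap.ker ((e : H →ₗ[ℂ] H) ∘ₗ G) = LinearMap.ker G :=
      LinearMap.ker_comp_of_ker_eq_bot _ e.ker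
    have hr : Module.finrank ℂ (H ⧸ LinearMap.range ((e : H →ₗ[ℂ] H) ∘ₗ G)) =
        Module.finrank ℂ (H ⧸ LinearMap.range G) :=
      (Submodule.Quotient.equiv (LinearMap.range G) _ e
        (LinearMap.range_comp G (e : H →ₗ[ℂ] H)).symm).finrank_eq.symm
    have := finrank_ker_eq_finrank_coker_id_add (hF.comp_left (W : H →ₗ[ℂ] H))
    rw [index, hT, hk, hr, sub_eq_zero]
    exact_mod_cast this

variable [CompleteSpace H]

/-- The class of Fredholm operators of index zero consists of the compact perturbations of
invertible operators. -/
theorem isFredholm_index_zero_iff (T : H →L[ℂ] H) :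
    (T.IsFredholm ∧ index T = 0) ↔ ∃ U : (H →L[ℂ] H)ˣ, IsCompactOperator (T - U : H →L[ℂ] H) := by
  constructor
  · rintro ⟨hT, hi⟩
    set N := LinearMap.ker (T : H →ₗ[ℂ] H)
    set R := LinearMap.range (T : H →ₗ[ℂ] H)
    have : FiniteDimensional ℂ N := hT.finite_ker
    have : FiniteDimensional ℂ (H ⧸ R) := hT.finite_coker
    have : CompleteSpace R := hT.isClosed_range.completeSpace_coe
    let q : (H ⧸ R) ≃ₗ[ℂ] Rᗮ := R.quotientEquivOfIsCompl Rᗮ R.isCompl_orthogonal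
    have : FiniteDimensional ℂ Rᗮ := q.finiteDimensional
    have hdim : Module.finrank ℂ N = Module.finrank ℂ Rᗮ := by
      rw [← q.finrank_eq]
      have := sub_eq_zero.1 hi
      exact_mod_cast this
    let L : N ≃L[ℂ] Rᗮ := ContinuousLinearEquiv.ofFinrankEq hdim
    -- Index zero makes `N` and `Rᗮ` isomorphic; `F` maps `N` onto `Rᗮ` and kills `Nᗮ`, so it
    -- repairs both defects of `T`.
    let F : H →L[ℂ] H := Rᗮ.subtypeL ∘L (L : N →L[ℂ] Rᗮ) ∘L N.orthogonalProjectionOnto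
    have hFmem : ∀ x, F x ∈ Rᗮ := fun x => (L (N.orthogonalProjectionOnto x)).2
    have hTmem : ∀ x, T x ∈ R := fun x => ⟨x, rfl⟩
    have hbij : Function.Bijective (T + F) := by
      constructor
      · rw [injective_iff_map_eq_zero]
        intro x hx
        have hx' : T x = -F x := eq_neg_of_add_eq_zero_left hx
        have hTx : T x = 0 := by
          have h2 : T x ∈ R ⊓ Rᗮ := ⟨hTmem x, hx' ▸ Rᗮ.neg_mem (hFmem x)⟩
          simpa [R.inf_orthogonal_eq_bot] using h2
        have hFx : F x = 0 := by simpa [hTx] using hx'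
        have hP : N.orthogonalProjectionOnto x = 0 := by
          have : L (N.orthogonalProjectionOnto x) = 0 := Subtype.ext hFx
          simpa using this
        have hxN : x ∈ N := hTx
        have := N.orthogonalProjectionOnto_mem_subspace_eq_self ⟨x, hxN⟩
        rw [hP] at this
        exact (congrArg Subtype.val this).symm
      · intro y
        obtain ⟨r, ⟨x, hx⟩, r', hr', rfl⟩ := R.exists_add_mem_mem_orthogonal y
        set n := L.symm ⟨r', hr'⟩
        have hn : T n = 0 := n.2
        have hp : T (N.orthogonalProjectionOnto x) = 0 := (N.orthogonalProjectionOnto x).2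
        -- The `Nᗮ` part of `x` produces `r` and is killed by `F`; `n` produces `r'` and is killed
        -- by `T`.
        refine ⟨x - N.orthogonalProjectionOnto x + n, ?_⟩
        have hF : F (x - N.orthogonalProjectionOnto x + n) = r' := by
          have : N.orthogonalProjectionOnto (x - N.orthogonalProjectionOnto x + n) = n := by
            rw [map_add, map_sub, Submodule.orthogonalProjectionOnto_mem_subspace_eq_self,
              Submodule.orthogonalProjectionOnto_mem_subspace_eq_self, sub_self, zero_add]
          change ((L (N.orthogonalProjectionOnto _) : Rᗮ) : H) = r'
          rw [this, ContinuousLinearEquiv.apply_symm_apply]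
        have hT' : T (x - N.orthogonalProjectionOnto x + n) = r := by
          rw [map_add, map_sub, hn, hp, sub_zero, add_zero]
          exact hx
        exact congrArg₂ (· + ·) hT' hF
    obtain ⟨U, hU⟩ := ContinuousLinearMap.isUnit_iff_bijective.2 hbij
    refine ⟨U, ?_⟩
    have : T - (U : H →L[ℂ] H) = -F := by rw [hU]; abel
    rw [this]
    have hc : IsCompactOperator (L : N →L[ℂ] Rᗮ) :=
      isCompactOperator_of_locallyCompactSpace_rng (L : N →L[ℂ] Rᗮ)
    exact ((hc.comp_clm N.orthogonalProjectionOnto).clm_comp Rᗮ.subtypeL).neg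
  · rintro ⟨U, hK⟩
    obtain ⟨ε, hε, hball⟩ := Metric.mem_nhds_iff.1 (Units.nhds U)
    obtain ⟨F, hF, hKF⟩ := exists_finiteRank_norm_sub_le hK (half_pos hε)
    obtain ⟨U', hU'⟩ : IsUnit (T - F) := hball <| by
      rw [Metric.mem_ball, dist_eq_norm]
      calc ‖T - F - (U : H →L[ℂ] H)‖ = ‖T - (U : H →L[ℂ] H) - F‖ := by congr 1; abel
        _ < ε := by linarith
    have := isFredholm_index_zero_of_unit_add_finiteRank U' hF
    rwa [hU', sub_add_cancel] at this

end Weyl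

/-! ### Perturbations staying inside an open group of units. -/

section OpenSubgroup

variable {B : Type*} [NormedRing B] [NormedAlgebra ℂ B] [CompleteSpace B]

/-- An open subgroup of the unit group contains the endpoint of a segment of units starting
in it. -/
theorem add_mem_image_val_of_segment {G : Subgroup Bˣ} (hG : IsOpen (G : Set Bˣ)) {b : Bˣ}
    (hb : b ∈ G) {x : B} (h : ∀ s : ℝ, s ∈ Set.Icc (0 : ℝ) 1 → IsUnit ((b : B) + (s : ℂ) • x)) :
    (b : B) + x ∈ Units.val '' (G : Set Bˣ) := by
  let f : Set.Icc (0 : ℝ) 1 → Bˣ := fun s => (h s s.2).unit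
  have hf : Continuous f := by
    rw [Units.isOpenEmbedding_val.isInducing.continuous_iff]
    have : (Units.val ∘ f) = fun s : Set.Icc (0 : ℝ) 1 => (b : B) + ((s : ℝ) : ℂ) • x := rfl
    rw [this]
    fun_prop
  have hclopen : IsClopen (f ⁻¹' (G : Set Bˣ)) :=
    IsClopen.preimage ⟨G.isClosed_of_isOpen hG, hG⟩ hf
  have h0 : f ⟨0, by simp⟩ = b := Units.ext (by simp [f])
  have huniv := hclopen.eq_univ ⟨⟨0, by simp⟩, show f _ ∈ G from h0 ▸ hb⟩
  have h1 : (⟨1, by simp⟩ : Set.Icc (0 : ℝ) 1) ∈ f ⁻¹' (G : Set Bˣ) := huniv ▸ Set.mem_univ _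
  exact ⟨_, h1, by simp [f]⟩

/-- A perturbation `x` of a unit `b` with `(x b⁻¹)²` small does not leave an open subgroup. -/
theorem add_mem_image_val_of_norm_lt {G : Subgroup Bˣ} (hG : IsOpen (G : Set Bˣ)) {b r x : B}
    (hb : b ∈ Units.val '' (G : Set Bˣ)) (hbr : b * r = 1) (h : ‖x * r * x * r‖ < 1) :
    b + x ∈ Units.val '' (G : Set Bˣ) := by
  obtain ⟨b, hb, rfl⟩ := hb
  obtain rfl : ↑b⁻¹ = r := Units.inv_eq_of_mul_eq_one_right hbr
  refine add_mem_image_val_of_segment hG hb fun s hs => ?_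
  set y : B := (s : ℂ) • (x * ↑b⁻¹) with hy
  have hyy : y * y = ((s : ℂ) * s) • (x * ↑b⁻¹ * x * ↑b⁻¹) := by
    rw [hy, smul_mul_smul_comm]; simp only [mul_assoc]
  have hlt : ‖y * y‖ < 1 := by
    refine lt_of_le_of_lt ?_ h
    rw [hyy, norm_smul]
    refine mul_le_of_le_one_left (norm_nonneg _) ?_
    rw [norm_mul, Complex.norm_real, Real.norm_of_nonneg hs.1]
    exact mul_le_one₀ hs.2 hs.1 hs.2
  -- Only `y²` is known to be small, so `1 + y` is inverted as a factor of `1 - y²`.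
  have hunit : IsUnit ((1 + y) * (1 - y)) := by
    have : (1 + y) * (1 - y) = 1 - y * y := by noncomm_ring
    rw [this]
    exact isUnit_one_sub_of_norm_lt_one hlt
  have hcomm : Commute (1 + y) (1 - y) := by
    change (1 + y) * (1 - y) = (1 - y) * (1 + y)
    noncomm_ring
  have : (b : B) + (s : ℂ) • x = (1 + y) * b := by
    rw [hy, add_mul, one_mul, smul_mul_assoc, mul_assoc, Units.inv_mul, mul_one]
  rw [this]
  exact (hcomm.isUnit_mul_iff.1 hunit).1.mul b.isUnit

end OpenSubgroup

/-! ### Stability of open unit groups under `ν`-convergence. -/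

section NuConvergence

variable {B : Type*} [NormedRing B]

theorem nuConverges_const (a : B) : NuConverges (fun _ => a) a :=
  ⟨⟨‖a‖, fun _ => le_rfl⟩, by simp, by simp⟩

variable [NormedAlgebra ℂ B]

/-- Along a `ν`-convergent sequence, with `E = u n - a`, the products `E r E r` are uniformly small
for all right inverses `r` of `a - z` or `u n - z` of bounded norm. -/
theorem NuConverges.eventually_norm_lt {u : ℕ → B} {a : B} (h : NuConverges u a) (C : ℝ) (z : ℂ)
    {δ : ℝ} (hδ : 0 < δ) :
    ∀ᶠ n in atTop, ∀ v r : B, (v = a ∨ v = u n) → (v - algebraMap ℂ B z) * r = 1 → ‖r‖ ≤ C →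
      ‖(u n - a) * r * (u n - a) * r‖ < δ := by
  obtain ⟨⟨M, hM⟩, h1, h2⟩ := h
  set η : ℕ → ℝ := fun n => ‖(u n - a) * a‖ + ‖(u n - a) * u n‖ with hη
  have hη0 : Tendsto η atTop (𝓝 0) := by simpa using h1.add h2
  have hEv : ∀ n v, (v = a ∨ v = u n) → ‖(u n - a) * v‖ ≤ η n := by
    rintro n v (rfl | rfl)
    · exact le_add_of_nonneg_right (norm_nonneg _)
    · exact le_add_of_nonneg_left (norm_nonneg _)
  rcases eq_or_ne z 0 with rfl | hz
  · have ht : Tendsto (fun n => η n * C * C * (η n * C * C)) atTop (𝓝 0) := by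
      simpa using ((hη0.mul_const C).mul_const C).mul ((hη0.mul_const C).mul_const C)
    filter_upwards [ht.eventually_lt_const hδ] with n hn v r hv hr hrC
    refine lt_of_le_of_lt ?_ hn
    have hr1 : v * r = 1 := by simpa using hr
    -- At `z = 0`, `v r = 1` lets a factor `v` be inserted next to `E`, at the cost of a second `r`.
    have hE : ‖(u n - a) * r‖ ≤ η n * C * C := by
      have : (u n - a) * r = (u n - a) * v * r * r := by
        rw [mul_assoc (u n - a), hr1, mul_one]
      rw [this]
      have hη' : 0 ≤ η n := (norm_nonneg _).trans (hEv n v hv)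
      have hC : 0 ≤ C := (norm_nonneg _).trans hrC
      refine (norm_mul_le _ _).trans (mul_le_mul ?_ hrC (norm_nonneg _) (by positivity))
      exact (norm_mul_le _ _).trans (mul_le_mul (hEv n v hv) hrC (norm_nonneg _) hη')
    rw [mul_assoc]
    exact (norm_mul_le _ _).trans (mul_le_mul hE hE (norm_nonneg _) ((norm_nonneg _).trans hE))
  · have ht : Tendsto (fun n => ‖z‖⁻¹ * (η n * C * ((M + ‖a‖) * C) + η n * C)) atTop (𝓝 0) := by
      simpa using (((hη0.mul_const C).mul_const ((M + ‖a‖) * C)).add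
        (hη0.mul_const C)).const_mul ‖z‖⁻¹
    filter_upwards [ht.eventually_lt_const hδ] with n hn v r hv hr hrC
    refine lt_of_le_of_lt ?_ hn
    have hη' : 0 ≤ η n := (norm_nonneg _).trans (hEv n v hv)
    have hC : 0 ≤ C := (norm_nonneg _).trans hrC
    set E := u n - a with hE
    have hEM : ‖E‖ ≤ M + ‖a‖ := (norm_sub_le _ _).trans (by gcongr; exact hM n)
    have hEE : ‖E * E‖ ≤ η n := by
      have : E * E = E * u n - E * a := by rw [← mul_sub]
      rw [this]
      exact (norm_sub_le _ _).trans_eq (add_comm _ _)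
    have key : z • (E * r * E * r) = E * v * r * (E * r) - E * E * r := by
      have hvr : v * r = 1 + z • r := by
        rw [sub_mul, ← Algebra.smul_def] at hr
        exact sub_eq_iff_eq_add.1 hr
      rw [mul_assoc E v r, hvr]
      simp only [mul_add, mul_one, add_mul, mul_smul_comm, smul_mul_assoc, mul_assoc]
      abel
    have hb : ‖z • (E * r * E * r)‖ ≤ η n * C * ((M + ‖a‖) * C) + η n * C := by
      rw [key]
      have e1 : ‖E * v * r‖ ≤ η n * C :=
        (norm_mul_le _ _).trans (mul_le_mul (hEv n v hv) hrC (norm_nonneg _) hη')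
      have e2 : ‖E * r‖ ≤ (M + ‖a‖) * C :=
        (norm_mul_le _ _).trans (mul_le_mul hEM hrC (norm_nonneg _) ((norm_nonneg _).trans hEM))
      have e3 : ‖E * E * r‖ ≤ η n * C :=
        (norm_mul_le _ _).trans (mul_le_mul hEE hrC (norm_nonneg _) hη')
      refine (norm_sub_le _ _).trans (add_le_add ?_ e3)
      exact (norm_mul_le _ _).trans (mul_le_mul e1 e2 (norm_nonneg _) (by positivity))
    rw [norm_smul] at hb
    rwa [inv_mul_eq_div, le_div_iff₀' (norm_pos_iff.2 hz)]

variable [CompleteSpace B]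

/-- If `a - z` lies in an open group of units, then so does `u n - w` for large `n` and `w` close
to `z`. -/
theorem NuConverges.eventually_sub_mem {G : Subgroup Bˣ} (hG : IsOpen (G : Set Bˣ)) {u : ℕ → B}
    {a : B} (h : NuConverges u a) {z : ℂ}
    (hz : a - algebraMap ℂ B z ∈ Units.val '' (G : Set Bˣ)) :
    ∀ᶠ p : ℕ × ℂ in atTop ×ˢ 𝓝 z,
      u p.1 - algebraMap ℂ B p.2 ∈ Units.val '' (G : Set Bˣ) := by
  obtain ⟨b, hb, hbz⟩ := id hz
  set r : B := ↑b⁻¹ with hr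
  have hbr : (a - algebraMap ℂ B z) * r = 1 := by rw [← hbz, hr, Units.mul_inv]
  obtain ⟨M, hM⟩ := h.1
  have hw : Tendsto (fun p : ℕ × ℂ => ‖z - p.2‖) (atTop ×ˢ 𝓝 z) (𝓝 0) := by
    have : Tendsto (fun w : ℂ => ‖z - w‖) (𝓝 z) (𝓝 0) := by
      have : Continuous fun w : ℂ => ‖z - w‖ := by fun_prop
      simpa using this.tendsto z
    exact this.comp tendsto_snd
  have ht : Tendsto (fun p : ℕ × ℂ => ‖z - p.2‖ * (2 * ((M + ‖a‖) * ‖r‖ * ‖r‖)) +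
      ‖z - p.2‖ * ‖z - p.2‖ * (‖r‖ * ‖r‖)) (atTop ×ˢ 𝓝 z) (𝓝 0) := by
    simpa using (hw.mul_const _).add ((hw.mul hw).mul_const _)
  have h1 := (h.eventually_norm_lt ‖r‖ z (half_pos one_pos)).prod_inl (𝓝 z)
  filter_upwards [h1, ht.eventually_lt_const (half_pos one_pos)] with p hp1 hp2
  have hE := hp1 a r (Or.inl rfl) hbr le_rfl
  set E := u p.1 - a with hEdef
  have hEM : ‖E‖ ≤ M + ‖a‖ := (norm_sub_le _ _).trans (by gcongr; exact hM p.1)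
  have hEr : ‖E * r‖ * ‖r‖ ≤ (M + ‖a‖) * ‖r‖ * ‖r‖ := by
    gcongr
    exact (norm_mul_le _ _).trans (by gcongr)
  set c := z - p.2
  have hsum : u p.1 - algebraMap ℂ B p.2 = (a - algebraMap ℂ B z) + (E + algebraMap ℂ B c) := by
    rw [hEdef, map_sub]; abel
  rw [hsum]
  refine add_mem_image_val_of_norm_lt hG hz hbr ?_
  -- The term free of `c` is below `1/2` by `ν`-convergence; the remaining terms total less than
  -- `1/2` for `p.2` near `z`.
  have hexp : (E + algebraMap ℂ B c) * r * (E + algebraMap ℂ B c) * r =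
      E * r * E * r + (c • (E * r * r) + c • (r * (E * r))) + (c * c) • (r * r) := by
    simp only [Algebra.algebraMap_eq_smul_one, add_mul, mul_add, smul_mul_assoc, mul_smul_comm,
      one_mul, mul_one, mul_assoc, smul_add, mul_smul]
    abel
  rw [hexp]
  have n1 : ‖c • (E * r * r)‖ ≤ ‖c‖ * ((M + ‖a‖) * ‖r‖ * ‖r‖) := by
    rw [norm_smul]; gcongr; exact (norm_mul_le _ _).trans hEr
  have n2 : ‖c • (r * (E * r))‖ ≤ ‖c‖ * ((M + ‖a‖) * ‖r‖ * ‖r‖) := by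
    rw [norm_smul]; gcongr; exact (norm_mul_le _ _).trans ((mul_comm _ _).trans_le hEr)
  have n3 : ‖(c * c) • (r * r)‖ ≤ ‖c‖ * ‖c‖ * (‖r‖ * ‖r‖) := by
    rw [norm_smul, norm_mul]; gcongr; exact norm_mul_le _ _
  have := norm_add₃_le (a := E * r * E * r) (b := c • (E * r * r) + c • (r * (E * r)))
    (c := (c * c) • (r * r))
  have := norm_add_le (c • (E * r * r)) (c • (r * (E * r)))
  linarith

/-- For large `n`, if `u n - z` lies in an open group of units and has an inverse of norm at
most `C`, then `a - z` lies in that group. -/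
theorem NuConverges.eventually_mem_of_sub_mem {G : Subgroup Bˣ} (hG : IsOpen (G : Set Bˣ))
    {u : ℕ → B} {a : B} (h : NuConverges u a) (C : ℝ) (z : ℂ) :
    ∀ᶠ n in atTop, u n - algebraMap ℂ B z ∈ Units.val '' (G : Set Bˣ) →
      ‖Ring.inverse (u n - algebraMap ℂ B z)‖ ≤ C →
        a - algebraMap ℂ B z ∈ Units.val '' (G : Set Bˣ) := by
  filter_upwards [h.eventually_norm_lt C z one_pos] with n hn hmem hC
  obtain ⟨b, -, hb⟩ := id hmem
  have hbr : (u n - algebraMap ℂ B z) * Ring.inverse (u n - algebraMap ℂ B z) = 1 :=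
    Ring.mul_inverse_cancel _ ⟨b, hb⟩
  -- The base point is now `u n - z`, perturbed back to `a - z`.
  have := add_mem_image_val_of_norm_lt hG (x := -(u n - a)) hmem hbr (by
    simpa only [neg_mul, mul_neg, neg_neg] using hn _ _ (Or.inr rfl) hbr hC)
  convert this using 1
  abel

end NuConvergence

/-! ### The Calkin algebra and the Weyl spectrum. -/

section CalkinAlgebra

variable {H : Type*} [NormedAddCommGroup H] [InnerProductSpace ℂ H]

theorem norm_toCalkin_le (T : H →L[ℂ] H) : ‖toCalkin T‖ ≤ ‖T‖ :=
  Submodule.Quotient.norm_mk_le (compactIdeal H) T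

theorem toCalkin_algebraMap (z : ℂ) :
    toCalkin (algebraMap ℂ (H →L[ℂ] H) z) = algebraMap ℂ (Calkin H) z := rfl

theorem toCalkin_eq_iff {S T : H →L[ℂ] H} :
    toCalkin S = toCalkin T ↔ IsCompactOperator (S - T : H →L[ℂ] H) :=
  Ideal.Quotient.eq

theorem isOpenMap_toCalkin : IsOpenMap (toCalkin : (H →L[ℂ] H) → Calkin H) :=
  QuotientAddGroup.isOpenMap_coe (N := (compactIdeal H).toAddSubgroup)

theorem norm_calkin_mul_le (x y : Calkin H) : ‖x * y‖ ≤ ‖x‖ * ‖y‖ := by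
  have hlim : Tendsto (fun ε : ℝ => (‖x‖ + ε) * (‖y‖ + ε)) (𝓝[>] 0) (𝓝 (‖x‖ * ‖y‖)) := by
    have : Continuous fun ε : ℝ => (‖x‖ + ε) * (‖y‖ + ε) := by fun_prop
    simpa using (this.tendsto 0).mono_left nhdsWithin_le_nhds
  refine ge_of_tendsto hlim ?_
  filter_upwards [self_mem_nhdsWithin] with ε hε
  obtain ⟨S, rfl, hS⟩ := Submodule.Quotient.norm_mk_lt x hε
  obtain ⟨T, rfl, hT⟩ := Submodule.Quotient.norm_mk_lt y hε
  calc ‖toCalkin S * toCalkin T‖ = ‖toCalkin (S * T)‖ := by rw [map_mul]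
    _ ≤ ‖S * T‖ := norm_toCalkin_le _
    _ ≤ ‖S‖ * ‖T‖ := norm_mul_le _ _
    _ ≤ _ := mul_le_mul hS.le hT.le (norm_nonneg _) ((norm_nonneg _).trans hS.le)

variable (H) in
/-- The group of cosets of invertible operators in the Calkin algebra. -/
def weylUnits : Subgroup (Calkin H)ˣ :=
  (Units.map (toCalkin : (H →L[ℂ] H) →+* Calkin H).toMonoidHom).range

theorem image_val_weylUnits :
    Units.val '' (weylUnits H : Set (Calkin H)ˣ) = toCalkin '' {U : H →L[ℂ] H | IsUnit U} := by
  ext x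
  constructor
  · rintro ⟨_, ⟨U, rfl⟩, rfl⟩
    exact ⟨U, U.isUnit, rfl⟩
  · rintro ⟨_, ⟨U, rfl⟩, rfl⟩
    exact ⟨_, ⟨U, rfl⟩, rfl⟩

variable [CompleteSpace H]

instance : IsClosed (compactIdeal H : Set (H →L[ℂ] H)) :=
  isClosed_setOfPred_isCompactOperator

instance : NormedRing (Calkin H) where
  __ := Ideal.Quotient.ring (compactIdeal H)
  __ := Submodule.Quotient.normedAddCommGroup (compactIdeal H)
  norm_mul_le := norm_calkin_mul_le

instance : NormedAlgebra ℂ (Calkin H) where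
  __ := Ideal.Quotient.algebra ℂ (I := compactIdeal H)
  norm_smul_le := norm_smul_le

/-- The invertible operators form an open set and the quotient map is open. -/
theorem isOpen_weylUnits : IsOpen (weylUnits H : Set (Calkin H)ˣ) := by
  rw [← Set.preimage_image_eq (weylUnits H : Set (Calkin H)ˣ) Units.val_injective,
    image_val_weylUnits]
  exact (isOpenMap_toCalkin _ Units.isOpen).preimage Units.continuous_val

/-- The bridge from Fredholm theory to the open-subgroup lemmas. -/
theorem notMem_weylSpectrum_iff {T : H →L[ℂ] H} {z : ℂ} :
    z ∉ weylSpectrum T ↔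
      toCalkin T - algebraMap ℂ (Calkin H) z ∈ Units.val '' (weylUnits H : Set (Calkin H)ˣ) := by
  rw [image_val_weylUnits, weylSpectrum, Set.mem_ofPred_eq, not_not, isFredholm_index_zero_iff,
    ← toCalkin_algebraMap, ← map_sub, Algebra.algebraMap_eq_smul_one]
  constructor
  · rintro ⟨U, hU⟩
    exact ⟨U, U.isUnit, (toCalkin_eq_iff.2 hU).symm⟩
  · rintro ⟨_, ⟨U, rfl⟩, hU⟩
    exact ⟨U, toCalkin_eq_iff.1 hU.symm⟩

theorem essentialSpectrum_subset_weylSpectrum (T : H →L[ℂ] H) :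
    essentialSpectrum T ⊆ weylSpectrum T := by
  intro z hz
  by_contra h
  obtain ⟨b, -, hb⟩ := notMem_weylSpectrum_iff.1 h
  refine spectrum.mem_iff.1 hz ?_
  rw [← neg_sub, ← hb]
  exact b.isUnit.neg

theorem NuConverges.toCalkin {u : ℕ → H →L[ℂ] H} {T : H →L[ℂ] H} (h : NuConverges u T) :
    NuConverges (fun n => NuWeyl.toCalkin (u n)) (NuWeyl.toCalkin T) := by
  obtain ⟨⟨M, hM⟩, h1, h2⟩ := h
  refine ⟨⟨M, fun n => (norm_toCalkin_le _).trans (hM n)⟩,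
    squeeze_zero (fun _ => norm_nonneg _) (fun n => ?_) h1,
    squeeze_zero (fun _ => norm_nonneg _) (fun n => ?_) h2⟩ <;>
  · rw [← map_sub, ← map_mul]
    exact norm_toCalkin_le _

/-- Upper semicontinuity of the Weyl spectrum, locally uniformly. -/
theorem NuConverges.eventually_notMem_weylSpectrum {u : ℕ → H →L[ℂ] H} {T : H →L[ℂ] H}
    (h : NuConverges u T) {z : ℂ} (hz : z ∉ weylSpectrum T) :
    ∀ᶠ p : ℕ × ℂ in atTop ×ˢ 𝓝 z, p.2 ∉ weylSpectrum (u p.1) := by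
  have key := NuConverges.eventually_sub_mem (B := Calkin H) (G := weylUnits H) isOpen_weylUnits
    (u := fun n => NuWeyl.toCalkin (u n)) h.toCalkin (notMem_weylSpectrum_iff.1 hz)
  filter_upwards [key] with p hp
  exact notMem_weylSpectrum_iff.2 hp

theorem isClosed_weylSpectrum (T : H →L[ℂ] H) : IsClosed (weylSpectrum T) := by
  rw [← isOpen_compl_iff, isOpen_iff_mem_nhds]
  intro z hz
  obtain ⟨pa, hpa, pb, hpb, hp⟩ := eventually_prod_iff.1
    -- For a constant sequence, local uniformity in the spectral parameter is openness of the
    -- complement.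
    ((nuConverges_const T).eventually_notMem_weylSpectrum hz)
  obtain ⟨n, hn⟩ := hpa.exists
  filter_upwards [hpb] with w hw
  exact hp hn hw

theorem weylSpectrum_subset_closedBall (T : H →L[ℂ] H) :
    weylSpectrum T ⊆ Metric.closedBall 0 ‖T‖ := by
  intro z hz
  have hspec : z ∈ spectrum ℂ T := by
    by_contra h
    refine notMem_weylSpectrum_iff.2 ?_ hz
    rw [image_val_weylUnits, ← toCalkin_algebraMap, ← map_sub]
    refine ⟨_, ?_, rfl⟩
    have := (spectrum.notMem_iff.1 h).neg
    rwa [neg_sub] at this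
  rw [mem_closedBall_zero_iff]
  -- Only `‖1‖ ≤ 1` is used, which also covers `H = 0`.
  refine (spectrum.norm_le_norm_mul_of_mem hspec).trans ?_
  exact mul_le_of_le_one_right (norm_nonneg _) ContinuousLinearMap.norm_id_le

theorem isCompact_weylSpectrum (T : H →L[ℂ] H) : IsCompact (weylSpectrum T) :=
  (isCompact_closedBall 0 ‖T‖).of_isClosed_subset (isClosed_weylSpectrum T)
    (weylSpectrum_subset_closedBall T)

/-- If the Weyl spectrum of an essentially `G₁` operator stays at distance `ε` from `z`, then the
resolvent at `z` in the Calkin algebra is bounded by `ε⁻¹`. -/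
theorem IsEssentiallyG1.norm_inverse_le {T : H →L[ℂ] H} (hT : IsEssentiallyG1 T) {z : ℂ} {ε : ℝ}
    (hε : 0 < ε) (h : ∀ w ∈ weylSpectrum T, ε ≤ dist z w) :
    ‖Ring.inverse (toCalkin T - algebraMap ℂ (Calkin H) z)‖ ≤ ε⁻¹ := by
  have hdist : ∀ w ∈ essentialSpectrum T, ε ≤ dist z w := fun w hw =>
    h w (essentialSpectrum_subset_weylSpectrum T hw)
  have hz : z ∉ essentialSpectrum T := fun hz => by
    have := hdist z hz
    rw [dist_self] at this
    exact this.not_gt hε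
  refine (hT z hz).trans_le ?_
  rw [one_div]
  -- For an empty spectrum `infDist` is `0` by convention, and `0⁻¹ = 0` keeps the bound true.
  rcases (essentialSpectrum T).eq_empty_or_nonempty with he | he
  · rw [he, Metric.infDist_empty, inv_zero]
    positivity
  · exact inv_anti₀ hε ((Metric.le_infDist he).2 fun {w} hw => hdist w hw)

end CalkinAlgebra

/-! ### From local semicontinuity to Hausdorff convergence. -/

section Hausdorff

/-- A criterion for convergence in the Hausdorff metric of uniformly bounded sets to a compact
set: no accumulation outside the limit, and approximation of every point of the limit. -/
theorem hausdorffConverges_of_local {E : ℕ → Set ℂ} {F : Set ℂ} (hF : IsCompact F) {M : ℝ}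
    (hE : ∀ n, E n ⊆ Metric.closedBall 0 M)
    (hupper : ∀ z ∉ F, ∀ᶠ p : ℕ × ℂ in atTop ×ˢ 𝓝 z, p.2 ∉ E p.1)
    (hlower : ∀ z ∈ F, ∀ ε > 0, ∀ᶠ n in atTop, ∃ w ∈ E n, dist z w < ε) :
    HausdorffConverges E F := by
  refine ENNReal.tendsto_nhds_zero.2 fun ε hε => ?_
  obtain ⟨δ, hδ0, hδε⟩ := ENNReal.lt_iff_exists_nnreal_btwn.1 hε
  have hδ : (0 : ℝ) < δ := by exact_mod_cast hδ0
  have hle : ∀ x y : ℂ, dist x y < δ → edist x y ≤ ε := fun x y hxy => by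
    refine le_trans ?_ hδε.le
    rw [edist_nndist]
    exact_mod_cast hxy.le
  -- Points of `E n` far from `F` could only lie in this compact set, which finitely many
  -- neighbourhoods from `hupper` cover.
  have hK : IsCompact (Metric.closedBall (0 : ℂ) M \ Metric.thickening δ F) :=
    (isCompact_closedBall 0 M).diff Metric.isOpen_thickening
  have hup : ∀ᶠ n in atTop, ∀ z ∈ Metric.closedBall (0 : ℂ) M \ Metric.thickening δ F,
      z ∉ E n := by
    refine (hK.induction_on (p := fun s => ∀ᶠ n in atTop, ∀ z ∈ s, z ∉ E n) (by simp)
      (fun s t hst ht => ht.mono fun n hn z hz => hn z (hst hz))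
      (fun s t hs ht => hs.mp (ht.mono fun n h1 h2 z hz => hz.elim (h2 z) (h1 z))) ?_)
    intro z hz
    obtain ⟨pa, hpa, pb, hpb, hp⟩ := eventually_prod_iff.1
      (hupper z fun hzF => hz.2 (Metric.self_subset_thickening hδ F hzF))
    exact ⟨{w | pb w}, mem_nhdsWithin_of_mem_nhds hpb,
      hpa.mono fun n hn w hw => hp hn hw⟩
  have hlo : ∀ᶠ n in atTop, ∀ z ∈ F, ∃ w ∈ E n, dist z w < δ := by
    refine (hF.induction_on (p := fun s => ∀ᶠ n in atTop, ∀ z ∈ s, ∃ w ∈ E n, dist z w < δ)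
      (by simp) (fun s t hst ht => ht.mono fun n hn z hz => hn z (hst hz))
      (fun s t hs ht => hs.mp (ht.mono fun n h1 h2 z hz => hz.elim (h2 z) (h1 z))) ?_)
    intro z hz
    refine ⟨Metric.ball z (δ / 2),
      mem_nhdsWithin_of_mem_nhds (Metric.ball_mem_nhds _ (by positivity)),
      (hlower z hz (δ / 2) (by positivity)).mono ?_⟩
    rintro n ⟨w, hw, hzw⟩ x hx
    refine ⟨w, hw, (dist_triangle x z w).trans_lt ?_⟩
    have := Metric.mem_ball.1 hx
    linarith
  filter_upwards [hup, hlo] with n h1 h2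
  refine Metric.hausdorffEDist_le_of_mem_edist (fun z hz => ?_) fun z hz => ?_
  · have hth : z ∈ Metric.thickening δ F := by
      by_contra hth
      exact h1 z ⟨hE n hz, hth⟩ hz
    obtain ⟨w, hw, hzw⟩ := Metric.mem_thickening_iff.1 hth
    exact ⟨w, hw, hle _ _ hzw⟩
  · obtain ⟨w, hw, hzw⟩ := h2 z hz
    exact ⟨w, hw, hle _ _ hzw⟩

/-- Weyl spectra of essentially `G₁` operators converge along `ν`-convergent sequences. -/
theorem NuConverges.hausdorffConverges_weylSpectrum {H : Type*} [NormedAddCommGroup H]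
    [InnerProductSpace ℂ H] [CompleteSpace H] {u : ℕ → H →L[ℂ] H} {T : H →L[ℂ] H}
    (hu : ∀ n, IsEssentiallyG1 (u n)) (h : NuConverges u T) :
    HausdorffConverges (fun n => weylSpectrum (u n)) (weylSpectrum T) := by
  obtain ⟨M, hM⟩ := h.1
  refine hausdorffConverges_of_local (isCompact_weylSpectrum T) (M := M)
    (fun n => (weylSpectrum_subset_closedBall _).trans (Metric.closedBall_subset_closedBall (hM n)))
    (fun z hz => ?_) fun z hz ε hε => ?_
  · exact h.eventually_notMem_weylSpectrum hz
  · have key := NuConverges.eventually_mem_of_sub_mem (B := Calkin H) (G := weylUnits H)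
      isOpen_weylUnits (u := fun n => NuWeyl.toCalkin (u n)) h.toCalkin ε⁻¹ z
    filter_upwards [key] with n hn
    -- If `σ_w(u n)` kept distance `ε` from `z`, the `G₁` bound `ε⁻¹` on the resolvent would force
    -- `z ∉ σ_w(T)`.
    by_contra! hfar
    have hzn : z ∉ weylSpectrum (u n) := fun hzn => by
      have := hfar z hzn
      rw [dist_self] at this
      exact this.not_gt hε
    exact notMem_weylSpectrum_iff.2
      (hn (notMem_weylSpectrum_iff.1 hzn) ((hu n).norm_inverse_le hε hfar)) hz

end Hausdorff

end NuWeyl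

end

theorem mainTheorem3 {H : Type*} [NormedAddCommGroup H] [InnerProductSpace ℂ H]
    [CompleteSpace H] :
    (∀ T : H →L[ℂ] H, T.IsFredholm →
      (0 ∉ NuWeyl.weylSpectrum T ∨ AccPt (0 : ℂ) (𝓟 (NuWeyl.weylSpectrum T))) →
      ∀ Tn : ℕ → H →L[ℂ] H, (∀ n, NuWeyl.IsEssentiallyG1 (Tn n)) →
        NuWeyl.NuConverges Tn T →
        NuWeyl.HausdorffConverges (fun n => NuWeyl.weylSpectrum (Tn n))
          (NuWeyl.weylSpectrum T)) ∧
    NuWeyl.NuContinuousOn (NuWeyl.weylSpectrum (H := H))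
      {T : H →L[ℂ] H | NuWeyl.IsEssentiallyG1 T} :=
  ⟨fun _ _ _ _ hTn h => h.hausdorffConverges_weylSpectrum hTn,
    fun _ _ _ hu h => h.hausdorffConverges_weylSpectrum hu⟩
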